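/- **Proposition (Properties of the DL divergence).** All Hilbert spaces are finite-dimensional and complex; a state is a positive semidefinite (PSD) operator of trace $1$. For Hermitian $A=\sum_i a_i|i\rangle\langle i|$ put $A_+=\sum_{i:a_i\ge 0}a_i|i\rangle\langle i|$. For a real number $\delta\ge 0$ and PSD operators $\rho,\sigma$ on the same space, the Datta–Leditzky (DL) divergence is $$\overline{D}^{\delta}(\rho\Vert\sigma)=\ln\inf\{\lambda\ge 0:\operatorname{Tr}[(\rho-\lambda\sigma)_+]\le\delta\}\in[-\infty,+\infty],$$ with $\inf\emptyset=+\infty$, $\ln 0=-\infty$ and $\ln(+\infty)=+\infty$. For a state $\rho$ and a PSD operator $\sigma$ put $D_{\max}(\rho\Vert\sigma)=\ln\inf\{\lambda:\rho\le\lambda\sigma\}$ and, for $\delta\in[0,1]$, $D_{\max}^{\delta}(\rho\Vert\sigma)=\inf_{\tilde\rho}D_{\max}(\tilde\rho\Vert\sigma)$, the infimum being over all states $\tilde\rho$ with $\frac12\Vert\tilde\rho-\rho\Vert_1\le\delta$. Let $\delta\in(0,1)$, let $\rho,\rho_1,\dots,\rho_k$ be states and let $\sigma,\sigma_1,\dots,\sigma_k$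 be PSD operators (on a common space in (1)–(3); in (4) $\rho_1,\sigma_1$ and $\rho_2,\sigma_2$ may act on different spaces). 1. *Data processing.* For every linear map $\mathcal N$ between operator spaces, possibly of different dimensions, that is positive ($X\ge0\Rightarrow\mathcal N(X)\ge0$) and trace non-increasing ($\operatorname{Tr}\mathcal N(X)\le\operatorname{Tr}X$ for $X\ge0$), $$\overline{D}^{\delta}(\rho\Vert\sigma)\ge\overline{D}^{\delta}(\mathcal N(\rho)\Vert\mathcal N(\sigma)).$$ 2. *Joint quasi-convexity.* Let $p_1,\dots,p_k\in[0,1]$ with $\sum_i p_i=1$. Then $$\overline{D}^{\delta}\Big(\sum_i p_i\rho_i\Big\Vert\sum_i p_i\sigma_i\Big)\le\max_i\overline{D}^{\delta}(\rho_i\Vert\sigma_i),$$ and, more generally, for all $\delta_1,\dots,\delta_k\in(0,1)$ and $\delta'=\sum_i p_i\delta_i$, $$\overline{D}^{\delta'}\Big(\sum_i p_i\rho_i\Big\Vert\sum_i p_i\sigma_i\Big)\le\max_i\overline{D}^{\delta_i}(\rho_i\Vert\sigma_i).$$ 3. *Relation to the smooth max-relative entropy.* With $\delta'=1-\sqrt{1-\delta^2}\in(0,1)$,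 $$\overline{D}^{\delta}(\rho\Vert\sigma)\le D_{\max}^{\delta}(\rho\Vert\sigma)\le\overline{D}^{\delta'}(\rho\Vert\sigma)-\ln(1-\delta'),$$ and the second inequality may be reparametrized as $$D_{\max}^{\sqrt{\delta(2-\delta)}}(\rho\Vert\sigma)\le\overline{D}^{\delta}(\rho\Vert\sigma)-\ln(1-\delta).$$ 4. *Quasi-subadditivity.* For $\delta_1,\delta_2\in(0,1)$ one has $\delta_i'=\sqrt{\delta_i(2-\delta_i)}\in(0,1)$ for $i\in\{1,2\}$, and if $\delta_1'+\delta_2'<1$, then $$\overline{D}^{\delta_1'+\delta_2'}(\rho_1\otimes\rho_2\Vert\sigma_1\otimes\sigma_2)\le\overline{D}^{\delta_1}(\rho_1\Vert\sigma_1)+\overline{D}^{\delta_2}(\rho_2\Vert\sigma_2)-\ln\big((1-\delta_1)(1-\delta_2)\big).$$ Furthermore: (a) $\overline{D}^{0}(\rho_1\otimes\rho_2\Vert\sigma_1\otimes\sigma_2)\le\overline{D}^{0}(\rho_1\Vert\sigma_1)+\overline{D}^{0}(\rho_2\Vert\sigma_2)$; (b) if $\sigma_1,\sigma_2$ are states,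 $\delta_1,\delta_2\in(0,1)$, and $$\delta_\ast=\min\big\{\delta_1+e^{\overline{D}^{\delta_1}(\rho_1\Vert\sigma_1)}\delta_2,\ \delta_2+e^{\overline{D}^{\delta_2}(\rho_2\Vert\sigma_2)}\delta_1\big\}$$ is finite (it is infinite only if both divergences are $+\infty$), then $$\overline{D}^{\delta_\ast}(\rho_1\otimes\rho_2\Vert\sigma_1\otimes\sigma_2)\le\overline{D}^{\delta_1}(\rho_1\Vert\sigma_1)+\overline{D}^{\delta_2}(\rho_2\Vert\sigma_2).$$ -/

import Mathlib

open scoped Kronecker NNReal ENNReal ComplexOrder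

noncomputable section

namespace QInfo

/-- Quantum states on the Hilbert space `ℂ^n` (`n` a finite index type), as density matrices:
positive semidefinite matrices of trace one. -/
def IsState {n : Type*} [Fintype n] (ρ : Matrix n n ℂ) : Prop :=
  ρ.PosSemidef ∧ ρ.trace = 1

/-- The positive part `A₊ = ∑_{i : aᵢ ≥ 0} aᵢ |i⟩⟨i|` of a Hermitian matrix `A = ∑ᵢ aᵢ |i⟩⟨i|`. -/
def matPosPart {n : Type*} [Fintype n] [DecidableEq n] (A : Matrix n n ℂ) : Matrix n n ℂ :=
  cfc (fun a : ℝ => max a 0) A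

/-- The trace norm `‖B‖₁ = Tr √(B† B)`. -/
def traceNorm {n : Type*} [Fintype n] [DecidableEq n] (B : Matrix n n ℂ) : ℝ :=
  (cfc Real.sqrt (B.conjTranspose * B)).trace.re

/-- The normalized trace distance `½ ‖ρ - σ‖₁`. -/
def traceDist {n : Type*} [Fintype n] [DecidableEq n] (ρ σ : Matrix n n ℂ) : ℝ :=
  1 / 2 * traceNorm (ρ - σ)

/-- The Datta--Leditzky information spectrum divergence
`ln inf {l ≥ 0 : Tr (ρ - l σ)₊ ≤ δ}`, with values in `[-∞, +∞]`; here `inf ∅ = +∞`,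
`ln 0 = -∞` and `ln (+∞) = +∞`. -/
def dlDiv {n : Type*} [Fintype n] [DecidableEq n] (δ : ℝ) (ρ σ : Matrix n n ℂ) : EReal :=
  ENNReal.log (⨅ (l : ℝ≥0) (_ : (matPosPart (ρ - (l : ℝ) • σ)).trace.re ≤ δ), (l : ℝ≥0∞))

/-- The max-relative entropy `ln inf {l : ρ ≤ l σ}` of a state `ρ` and a positive semidefinite
matrix `σ`, with values in `[-∞, +∞]`. Every `l` with `ρ ≤ l σ` is positive because `ρ` has
trace one, so restricting to `l ≥ 0` changes nothing. -/
def dMax {n : Type*} [Fintype n] (ρ σ : Matrix n n ℂ) : EReal :=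
  ENNReal.log (⨅ (l : ℝ≥0) (_ : ((l : ℝ) • σ - ρ).PosSemidef), (l : ℝ≥0∞))

/-- The smooth max-relative entropy: the infimum of `dMax τ σ` over all states `τ` with
`½ ‖τ - ρ‖₁ ≤ δ`. -/
def smoothDMax {n : Type*} [Fintype n] [DecidableEq n] (δ : ℝ) (ρ σ : Matrix n n ℂ) : EReal :=
  ⨅ (τ : Matrix n n ℂ) (_ : IsState τ) (_ : traceDist τ ρ ≤ δ), dMax τ σ

/-- A linear map on matrices is positive if it maps positive semidefinite matrices to positive
semidefinite matrices. -/
def IsPositiveMap {n m : Type*} [Fintype n] [Fintype m]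
    (N : Matrix n n ℂ →ₗ[ℂ] Matrix m m ℂ) : Prop :=
  ∀ X : Matrix n n ℂ, X.PosSemidef → (N X).PosSemidef

/-- A linear map on matrices is trace non-increasing if `Tr N(X) ≤ Tr X` for all positive
semidefinite `X`. -/
def IsTraceNonincreasing {n m : Type*} [Fintype n] [Fintype m]
    (N : Matrix n n ℂ →ₗ[ℂ] Matrix m m ℂ) : Prop :=
  ∀ X : Matrix n n ℂ, X.PosSemidef → (N X).trace.re ≤ X.trace.re

end QInfo

end

open QInfo

open QInfo

/-! ### Loewner order, positive parts and trace distance. -/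

section PositiveParts

open scoped MatrixOrder
open Matrix

variable {n m : Type*}

/-! Everything rests on a dual description of the positive part: for Hermitian `A`, `Tr A₊` is the
least trace of an `X ≥ 0` with `A ≤ X` (`re_trace_matPosPart_le_iff`). So `l` is admissible for the
divergence exactly when `ρ ≤ lσ + X` for some `X ≥ 0` of trace at most `δ`. For `δ < 1` a divergence
other than `+∞` is attained at some `l > 0` (`dlDiv_eq_top_or_exists_isDLWitness`), so each claim
reduces to building a new witness `X`. Positive trace non-increasing maps, convex combinations and
tensor products all carry witnesses to witnesses; a state `τ ≤ lσ` close to `ρ` yields the witness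
`(ρ - τ)₊`.

The hard direction is to extract a nearby state from a witness (`exists_state_le_smul`). With `A =
lσ` and `B = lσ + X`, the contraction `G = √A (√B)⁻¹` gives `G ρ G† ≤ G B G† ≤ A`, and operator
monotonicity of the square root gives `Re Tr (G ρ) ≥ 1 - δ`. Filling `G ρ G†` up to a state below
`(l / (1 - δ)) σ` and applying a Fuchs-van de Graaf argument bounds the distance by `√(1 - (1 - δ)²)
= √(δ (2 - δ))`. No fidelity or purification is needed, since `G` itself provides the overlap.
Quasi-subadditivity then follows by tensoring two such states. -/

theorem real_smul_nonneg {A : Matrix n n ℂ} (hA : 0 ≤ A) {c : ℝ} (hc : 0 ≤ c) : 0 ≤ c • A :=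
  (hA.posSemidef.smul hc).nonneg

theorem real_smul_mono {A B : Matrix n n ℂ} (h : A ≤ B) {c : ℝ} (hc : 0 ≤ c) :
    c • A ≤ c • B := by
  rw [← sub_nonneg, ← smul_sub]
  exact real_smul_nonneg (sub_nonneg.2 h) hc

theorem real_smul_mono_left {A : Matrix n n ℂ} (hA : 0 ≤ A) {c d : ℝ} (h : c ≤ d) :
    c • A ≤ d • A := by
  rw [← sub_nonneg, ← sub_smul]
  exact real_smul_nonneg hA (sub_nonneg.2 h)

variable [Fintype n] [Fintype m]

theorem re_trace_mono {A B : Matrix n n ℂ} (h : A ≤ B) : A.trace.re ≤ B.trace.re := by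
  have h1 : 0 ≤ (B - A).trace.re := (Complex.le_def.1 (Matrix.le_iff.1 h).trace_nonneg).1
  rw [trace_sub, Complex.sub_re] at h1
  linarith

theorem re_trace_nonneg {A : Matrix n n ℂ} (h : 0 ≤ A) : 0 ≤ A.trace.re := by
  simpa using re_trace_mono h

theorem conj_nonneg {A : Matrix n n ℂ} (h : 0 ≤ A) (X : Matrix m n ℂ) : 0 ≤ X * A * Xᴴ :=
  (h.posSemidef.mul_mul_conjTranspose_same X).nonneg

theorem conj_mono {A B : Matrix n n ℂ} (h : A ≤ B) (X : Matrix m n ℂ) :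
    X * A * Xᴴ ≤ X * B * Xᴴ := by
  rw [← sub_nonneg, ← Matrix.sub_mul, ← Matrix.mul_sub]
  exact conj_nonneg (sub_nonneg.2 h) X

theorem re_trace_smul (c : ℝ) (A : Matrix n n ℂ) : (c • A).trace.re = c * A.trace.re := by
  simp [trace_smul]

theorem kronecker_nonneg {A : Matrix n n ℂ} {B : Matrix m m ℂ} (hA : 0 ≤ A) (hB : 0 ≤ B) :
    0 ≤ A ⊗ₖ B :=
  (hA.posSemidef.kronecker hB.posSemidef).nonneg

theorem re_trace_kronecker {A : Matrix n n ℂ} {B : Matrix m m ℂ} (hA : 0 ≤ A) :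
    (A ⊗ₖ B).trace.re = A.trace.re * B.trace.re := by
  have h : A.trace.im = 0 := (Complex.le_def.1 hA.posSemidef.trace_nonneg).2.symm
  rw [trace_kronecker, Complex.mul_re, h, zero_mul, sub_zero]

variable [DecidableEq n]

theorem re_trace_mul_nonneg {A B : Matrix n n ℂ} (hA : 0 ≤ A) (hB : 0 ≤ B) :
    0 ≤ (A * B).trace.re := by
  obtain ⟨Y, rfl⟩ := CStarAlgebra.nonneg_iff_eq_star_mul_self.mp hB
  rw [star_eq_conjTranspose, ← Matrix.mul_assoc, trace_mul_comm, ← Matrix.mul_assoc]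
  exact re_trace_nonneg (conj_nonneg hA Y)

theorem continuousOn_real_spectrum (A : Matrix n n ℂ) (f : ℝ → ℝ) :
    ContinuousOn f (spectrum ℝ A) :=
  Matrix.finite_real_spectrum.continuousOn f

theorem matPosPart_nonneg (A : Matrix n n ℂ) : 0 ≤ matPosPart A :=
  cfc_nonneg fun _ _ => le_max_right _ _

theorem le_matPosPart {A : Matrix n n ℂ} (hA : A.IsHermitian) : A ≤ matPosPart A := by
  conv_lhs => rw [← cfc_id' ℝ A hA.isSelfAdjoint]
  exact cfc_mono (fun _ _ => le_max_left _ _) (continuousOn_real_spectrum A _)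
    (continuousOn_real_spectrum A _)

/-- The trace of the positive part is attained at a projection commuting with the matrix. -/
theorem exists_projection_trace_matPosPart {A : Matrix n n ℂ} (hA : A.IsHermitian) :
    ∃ P : Matrix n n ℂ, P.IsHermitian ∧ P * P = P ∧ 0 ≤ P ∧ P ≤ 1 ∧ P * A = matPosPart A := by
  have hc := continuousOn_real_spectrum A
  have hs : IsSelfAdjoint A := hA
  refine ⟨cfc (fun x : ℝ => if 0 ≤ x then 1 else 0) A, cfc_predicate _ A, ?_, ?_, ?_, ?_⟩
  · rw [← cfc_mul _ _ A (hc _) (hc _)]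
    congr 1
    ext x
    split_ifs <;> simp
  · exact cfc_nonneg fun x _ => by split_ifs <;> simp
  · exact cfc_le_one _ A fun x _ => by split_ifs <;> simp
  · conv_lhs => rw [← cfc_id' ℝ A hs, cfc_id' ℝ A hs]
    nth_rewrite 2 [← cfc_id' ℝ A hs]
    rw [← cfc_mul _ _ A (hc _) (hc _), matPosPart]
    congr 1
    ext x
    split_ifs with h
    · simp [h]
    · simp [(not_le.1 h).le]

/-- Weak duality: with `P` the projection onto the nonnegative part, `Tr A₊ = Tr P A ≤ Tr P X ≤ Tr
X`. -/
theorem re_trace_matPosPart_le {A X : Matrix n n ℂ} (hA : A.IsHermitian) (hX : 0 ≤ X)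
    (h : A ≤ X) : (matPosPart A).trace.re ≤ X.trace.re := by
  obtain ⟨P, -, -, hP0, hP1, hPA⟩ := exists_projection_trace_matPosPart hA
  have h1 := re_trace_mul_nonneg hP0 (sub_nonneg.2 h)
  have h2 := re_trace_mul_nonneg (sub_nonneg.2 hP1) hX
  rw [Matrix.mul_sub, trace_sub, Complex.sub_re, hPA] at h1
  rw [Matrix.sub_mul, trace_sub, Complex.sub_re, Matrix.one_mul] at h2
  linarith

theorem re_trace_matPosPart_le_iff {A : Matrix n n ℂ} (hA : A.IsHermitian) {t : ℝ} :
    (matPosPart A).trace.re ≤ t ↔ ∃ X : Matrix n n ℂ, 0 ≤ X ∧ A ≤ X ∧ X.trace.re ≤ t :=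
  ⟨fun h => ⟨_, matPosPart_nonneg A, le_matPosPart hA, h⟩,
    fun ⟨_, hX, hAX, ht⟩ => (re_trace_matPosPart_le hA hX hAX).trans ht⟩

/-- On the spectrum this is `|x| = 2 max(x, 0) - x`, and `|x| = √(x²)`. -/
theorem traceNorm_eq_re_trace_abs {A : Matrix n n ℂ} (hA : A.IsHermitian) :
    traceNorm A = 2 * (matPosPart A).trace.re - A.trace.re := by
  have hc := continuousOn_real_spectrum A
  have hs : IsSelfAdjoint A := hA
  have h1 : Aᴴ * A = cfc (fun x : ℝ => x * x) A := by
    rw [cfc_mul _ _ A (hc _) (hc _), cfc_id' ℝ A hs, hA.eq]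
  have h2 : cfc Real.sqrt (Aᴴ * A) = (2 : ℝ) • matPosPart A - A := by
    have h3 : cfc (fun x : ℝ => (2 : ℝ) • max x 0 - x) A = (2 : ℝ) • matPosPart A - A := by
      rw [cfc_sub _ _ A (hc _) (hc _), cfc_id' ℝ A hs, cfc_smul _ _ A (hc _), matPosPart]
    rw [h1, ← cfc_comp' Real.sqrt _ A (by fun_prop) (hc _), ← h3]
    congr 1
    ext x
    rw [Real.sqrt_mul_self_eq_abs]
    rcases le_total 0 x with h | h
    · rw [abs_of_nonneg h, max_eq_left h]; simp only [smul_eq_mul]; ring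
    · rw [abs_of_nonpos h, max_eq_right h]; simp
  rw [traceNorm, h2, trace_sub, Complex.sub_re, re_trace_smul]

theorem traceDist_eq {ρ τ : Matrix n n ℂ} (hρ : IsState ρ) (hτ : IsState τ) :
    traceDist τ ρ = (matPosPart (ρ - τ)).trace.re := by
  have h : traceNorm (τ - ρ) = traceNorm (ρ - τ) := by
    rw [traceNorm, traceNorm, ← neg_sub ρ τ, conjTranspose_neg, neg_mul_neg]
  rw [traceDist, h, traceNorm_eq_re_trace_abs (hρ.1.isHermitian.sub hτ.1.isHermitian), trace_sub,
    hρ.2, hτ.2]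
  simp

end PositiveParts

/-! ### From a witness to a nearby state. -/

section Smoothing

open scoped MatrixOrder
open Matrix

variable {n : Type*} [Fintype n]

theorem re_trace_conjTranspose_mul (G : Matrix n n ℂ) {A : Matrix n n ℂ} (hA : A.IsHermitian) :
    (Gᴴ * A).trace.re = (G * A).trace.re := by
  have : (Gᴴ * A).trace = star (G * A).trace := by
    rw [← trace_conjTranspose, conjTranspose_mul, hA.eq, trace_mul_comm]
  rw [this]
  simp

/-- The Cauchy-Schwarz inequality for the form `(X, Y) ↦ Tr (X ρ Y†)`. -/
theorem re_trace_mul_mul_conjTranspose_sq_le {ρ : Matrix n n ℂ} (hρ : 0 ≤ ρ)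
    (X Y : Matrix n n ℂ) :
    (X * ρ * Yᴴ).trace.re ^ 2 ≤ (X * ρ * Xᴴ).trace.re * (Y * ρ * Yᴴ).trace.re := by
  have hsymm : (Y * ρ * Xᴴ).trace.re = (X * ρ * Yᴴ).trace.re := by
    have : (Y * ρ * Xᴴ).trace = star (X * ρ * Yᴴ).trace := by
      rw [← trace_conjTranspose, conjTranspose_mul, conjTranspose_mul, conjTranspose_conjTranspose,
        hρ.posSemidef.isHermitian.eq, Matrix.mul_assoc]
    rw [this]
    simp
  -- The form evaluated at `xX + Y` is a nonnegative real quadratic in `x`, so its discriminant is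
  -- nonpositive.
  have hq : ∀ x : ℝ, 0 ≤ (X * ρ * Xᴴ).trace.re * (x * x) + (2 * (X * ρ * Yᴴ).trace.re) * x +
      (Y * ρ * Yᴴ).trace.re := by
    intro x
    have h := re_trace_nonneg (conj_nonneg hρ (x • X + Y))
    have he : (x • X + Y) * ρ * (x • X + Y)ᴴ = x • x • (X * ρ * Xᴴ) + x • (X * ρ * Yᴴ) +
        (x • (Y * ρ * Xᴴ) + Y * ρ * Yᴴ) := by
      simp only [conjTranspose_add, conjTranspose_smul, star_trivial, Matrix.add_mul,
        Matrix.mul_add, Matrix.smul_mul, Matrix.mul_smul, smul_add]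
      abel
    rw [he] at h
    simp only [trace_add, Complex.add_re, re_trace_smul, hsymm] at h
    linarith
  have := discrim_le_zero hq
  rw [discrim] at this
  linarith

/-- The trace is affine along the segment from `A` to `B`, so it equals `1` at some point of it. -/
theorem exists_state_between {A B : Matrix n n ℂ} (hA : 0 ≤ A) (h : A ≤ B)
    (hA1 : A.trace.re ≤ 1) (hB1 : 1 ≤ B.trace.re) :
    ∃ τ : Matrix n n ℂ, IsState τ ∧ A ≤ τ ∧ τ ≤ B := by
  obtain ⟨c, hc0, hc1, hc⟩ : ∃ c : ℝ, 0 ≤ c ∧ c ≤ 1 ∧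
      A.trace.re + c * (B.trace.re - A.trace.re) = 1 := by
    rcases (hA1.trans hB1).eq_or_lt with he | hl
    · exact ⟨0, le_rfl, zero_le_one, by linarith⟩
    · have hpos := sub_pos.2 hl
      refine ⟨(1 - A.trace.re) / (B.trace.re - A.trace.re), div_nonneg (by linarith) hpos.le,
        (div_le_one hpos).2 (by linarith), ?_⟩
      field_simp
      ring
  have hD := sub_nonneg.2 h
  have h1 : A ≤ A + c • (B - A) := le_add_of_nonneg_right (real_smul_nonneg hD hc0)
  refine ⟨A + c • (B - A), ⟨(hA.trans h1).posSemidef, ?_⟩, h1, ?_⟩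
  · apply Complex.ext
    · rw [trace_add, Complex.add_re, re_trace_smul, trace_sub, Complex.sub_re, hc, Complex.one_re]
    · rw [Complex.one_im]
      exact (Complex.le_def.1 (hA.trans h1).posSemidef.trace_nonneg).2.symm
  · have := real_smul_mono_left hD hc1
    rw [one_smul] at this
    calc A + c • (B - A) ≤ A + (B - A) := by gcongr
      _ = B := by abel

/-- Cauchy-Schwarz for the pair `P G`, `P`, with `P G ρ G† P ≤ P τ P`. It bounds the share of the
overlap `Tr (G ρ)` seen by one measurement outcome. -/
theorem re_trace_projection_mul_sq_le {ρ τ G P : Matrix n n ℂ} (hρ : 0 ≤ ρ)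
    (hP : P.IsHermitian) (hPP : P * P = P) (hτ : G * ρ * Gᴴ ≤ τ) :
    (P * (G * ρ)).trace.re ^ 2 ≤ (P * τ).trace.re * (P * ρ).trace.re := by
  have hcyc : ∀ Z : Matrix n n ℂ, (P * Z * P).trace = (P * Z).trace := fun Z => by
    rw [trace_mul_comm, ← Matrix.mul_assoc, hPP]
  have h := re_trace_mul_mul_conjTranspose_sq_le hρ (P * G) P
  have e1 : P * G * ρ * Pᴴ = P * (G * ρ) * P := by rw [hP.eq]; simp only [Matrix.mul_assoc]
  have e2 : P * G * ρ * (P * G)ᴴ = P * (G * ρ * Gᴴ) * P := by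
    rw [conjTranspose_mul, hP.eq]; simp only [Matrix.mul_assoc]
  rw [e1, e2, hP.eq, hcyc, hcyc, hcyc] at h
  have h2 : (P * (G * ρ * Gᴴ)).trace.re ≤ (P * τ).trace.re := by
    have := re_trace_mono (conj_mono hτ P)
    rwa [hP.eq, hcyc, hcyc] at this
  have h3 : 0 ≤ (P * ρ).trace.re := by
    have := re_trace_nonneg (conj_nonneg hρ P)
    rwa [hP.eq, hcyc] at this
  exact h.trans (mul_le_mul_of_nonneg_right h2 h3)

variable [DecidableEq n]

open scoped Matrix.Norms.L2Operator in
theorem cfc_sqrt_mono {A B : Matrix n n ℂ} (hA : 0 ≤ A) (h : A ≤ B) :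
    cfc Real.sqrt A ≤ cfc Real.sqrt B := by
  have := CFC.sqrt_le_sqrt A B h
  rwa [CFC.sqrt_eq_real_sqrt A hA, CFC.sqrt_eq_real_sqrt B (hA.trans h), cfcₙ_eq_cfc,
    cfcₙ_eq_cfc] at this

theorem cfc_sqrt_nonneg (A : Matrix n n ℂ) : 0 ≤ cfc Real.sqrt A :=
  cfc_nonneg fun x _ => Real.sqrt_nonneg x

theorem cfc_sqrt_mul_self {A : Matrix n n ℂ} (hA : 0 ≤ A) :
    cfc Real.sqrt A * cfc Real.sqrt A = A := by
  have hc := continuousOn_real_spectrum A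
  rw [← cfc_mul _ _ A (hc _) (hc _)]
  conv_rhs => rw [← cfc_id' ℝ A hA.posSemidef.isHermitian.isSelfAdjoint]
  refine cfc_congr fun x hx => Real.mul_self_sqrt (spectrum_nonneg_of_nonneg hA hx)

/-- For `0 ≤ A ≤ B` there is a contraction `G`, namely `√A (√B)⁻¹` with the inverse taken on the
support of `B`, that compresses `B` below `A`. -/
theorem exists_contraction_of_le {A B : Matrix n n ℂ} (hA : 0 ≤ A) (h : A ≤ B) :
    ∃ G : Matrix n n ℂ, Gᴴ * G ≤ 1 ∧ G * B * Gᴴ ≤ A ∧ A.trace.re ≤ (G * B).trace.re := by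
  have hB := hA.trans h
  have hBs : IsSelfAdjoint B := hB.posSemidef.isHermitian
  have hc := continuousOn_real_spectrum B
  set S := cfc Real.sqrt A with hS
  -- As `0⁻¹ = 0`, this is the inverse square root on the support of `B` and zero on its kernel.
  set R := cfc (fun x : ℝ => (√x)⁻¹) B with hR
  have hSH : Sᴴ = S := cfc_predicate Real.sqrt A
  have hRH : Rᴴ = R := cfc_predicate (fun x : ℝ => (√x)⁻¹) B
  have hSS : S * S = A := cfc_sqrt_mul_self hA
  have hRB : R * B = cfc Real.sqrt B := by
    conv_lhs => rw [← cfc_id' ℝ B hBs, hR, cfc_id' ℝ B hBs]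
    nth_rewrite 2 [← cfc_id' ℝ B hBs]
    rw [← cfc_mul _ _ B (hc _) (hc _)]
    refine cfc_congr fun x hx => ?_
    have hx : 0 ≤ x := spectrum_nonneg_of_nonneg hB hx
    rcases hx.eq_or_lt with rfl | hx'
    · simp
    · have := Real.sqrt_pos.2 hx'
      field_simp
      exact (Real.sq_sqrt hx).symm
  have hRBR : R * B * R ≤ 1 := by
    rw [hRB, hR, ← cfc_mul _ _ B (hc _) (hc _)]
    refine cfc_le_one _ B fun x _ => ?_
    exact mul_inv_le_one
  refine ⟨S * R, ?_, ?_, ?_⟩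
  · rw [conjTranspose_mul, hSH, hRH, Matrix.mul_assoc, ← Matrix.mul_assoc S, hSS,
      ← Matrix.mul_assoc]
    refine le_trans ?_ hRBR
    simpa [hRH] using conj_mono h R
  · have := conj_mono hRBR S
    simpa [conjTranspose_mul, hSH, hRH, hSS, Matrix.mul_assoc] using this
  · have h1 := re_trace_mul_nonneg (cfc_sqrt_nonneg A) (sub_nonneg.2 (cfc_sqrt_mono hA h))
    rw [Matrix.mul_sub, trace_sub, Complex.sub_re, cfc_sqrt_mul_self hA] at h1
    rw [Matrix.mul_assoc, hRB]
    linarith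

/-- The real part of `1 - G` is positive for a contraction: `2 - G - G† = (1 - G)†(1 - G) + (1 -
G†G) ≥ 0`. Pairing it with `B - ρ ≥ 0` gives the claim. -/
theorem re_trace_sub_contraction_mul_le {G ρ B : Matrix n n ℂ} (hG : Gᴴ * G ≤ 1)
    (h : ρ ≤ B) :
    ρ.trace.re - (G * ρ).trace.re ≤ B.trace.re - (G * B).trace.re := by
  have hD := sub_nonneg.2 h
  have h1 : 0 ≤ ((1 - G)ᴴ * (1 - G) + (1 - Gᴴ * G)) :=
    add_nonneg (posSemidef_conjTranspose_mul_self _).nonneg (sub_nonneg.2 hG)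
  have h2 : (1 - G)ᴴ * (1 - G) + (1 - Gᴴ * G) = 1 + 1 - G - Gᴴ := by
    rw [conjTranspose_sub, conjTranspose_one]
    noncomm_ring
  rw [h2] at h1
  have h3 := re_trace_mul_nonneg h1 hD
  have h4 := re_trace_conjTranspose_mul G hD.posSemidef.isHermitian
  simp only [Matrix.sub_mul, Matrix.add_mul, Matrix.one_mul, trace_sub, trace_add, Complex.sub_re,
    Complex.add_re, Matrix.mul_sub] at h3 h4
  linarith

/-- The two-outcome classical Fuchs-van de Graaf inequality. Bounding `2uv` by the AM-GM inequality
gives `(u + v)² ≤ 1 - (p - q)²`. -/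
theorem sub_le_sqrt_one_sub_sq {p q u v f : ℝ} (hp : 0 ≤ p) (hp1 : p ≤ 1) (hq : 0 ≤ q)
    (hq1 : q ≤ 1) (hu : u ^ 2 ≤ q * p) (hv : v ^ 2 ≤ (1 - q) * (1 - p)) (hf : 0 ≤ f)
    (h : f ≤ u + v) : p - q ≤ √(1 - f ^ 2) := by
  have ha : 0 ≤ p * (1 - p) := mul_nonneg hp (by linarith)
  have hb : 0 ≤ q * (1 - q) := mul_nonneg hq (by linarith)
  have h1 : u ^ 2 * v ^ 2 ≤ q * p * ((1 - q) * (1 - p)) :=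
    mul_le_mul hu hv (sq_nonneg v) (mul_nonneg hq hp)
  have h2 : 2 * (u * v) ≤ p * (1 - p) + q * (1 - q) := by
    refine le_of_abs_le (abs_le_of_sq_le_sq ?_ (add_nonneg ha hb))
    nlinarith [sq_nonneg (p * (1 - p) - q * (1 - q))]
  have h3 : f ^ 2 ≤ (u + v) ^ 2 := pow_le_pow_left₀ hf h 2
  exact Real.le_sqrt_of_sq_le (by nlinarith)

/-- A Fuchs-van de Graaf type bound: the overlap `Re Tr (G ρ)` controls the distance of `ρ` from
every state above `G ρ G†`. -/
theorem re_trace_matPosPart_sub_le {ρ τ G : Matrix n n ℂ} (hρ : IsState ρ) (hτ : IsState τ)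
    (hG : G * ρ * Gᴴ ≤ τ) {f : ℝ} (hf : 0 ≤ f) (h : f ≤ (G * ρ).trace.re) :
    (matPosPart (ρ - τ)).trace.re ≤ √(1 - f ^ 2) := by
  obtain ⟨P, hP, hPP, hP0, hP1, hPA⟩ :=
    exists_projection_trace_matPosPart (hρ.1.isHermitian.sub hτ.1.isHermitian)
  have hQ1 := sub_nonneg.2 hP1
  have hQ : (1 - P).IsHermitian := isHermitian_one.sub hP
  have hQQ : (1 - P) * (1 - P) = 1 - P := by
    rw [Matrix.mul_sub, Matrix.sub_mul, Matrix.sub_mul, hPP]; simp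
  -- Measure with `{P, 1 - P}`, where `p = Tr P ρ` and `q = Tr P τ`; the two overlaps add up to `Re
  -- Tr (G ρ)`.
  have hu := re_trace_projection_mul_sq_le hρ.1.nonneg hP hPP hG
  have hv := re_trace_projection_mul_sq_le hρ.1.nonneg hQ hQQ hG
  have hp0 := re_trace_mul_nonneg hP0 hρ.1.nonneg
  have hp1 := re_trace_mul_nonneg hQ1 hρ.1.nonneg
  have hq0 := re_trace_mul_nonneg hP0 hτ.1.nonneg
  have hq1 := re_trace_mul_nonneg hQ1 hτ.1.nonneg
  simp only [Matrix.sub_mul, Matrix.one_mul, trace_sub, Complex.sub_re, hρ.2, hτ.2,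
    Complex.one_re] at hv hp1 hq1
  rw [← hPA, Matrix.mul_sub, trace_sub, Complex.sub_re]
  exact sub_le_sqrt_one_sub_sq hp0 (by linarith) hq0 (by linarith) hu hv hf (by linarith)

theorem exists_state_le_smul {ρ σ X : Matrix n n ℂ} (hρ : IsState ρ) (hσ : 0 ≤ σ) {l δ : ℝ}
    (hl : 0 ≤ l) (hδ0 : 0 ≤ δ) (hδ1 : δ < 1) (hX : 0 ≤ X) (h : ρ - l • σ ≤ X)
    (hXδ : X.trace.re ≤ δ) :
    ∃ τ : Matrix n n ℂ, IsState τ ∧ τ ≤ (l / (1 - δ)) • σ ∧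
      (matPosPart (ρ - τ)).trace.re ≤ √(δ * (2 - δ)) := by
  have hA := real_smul_nonneg hσ hl
  have hρB : ρ ≤ l • σ + X := by rwa [sub_le_iff_le_add'] at h
  obtain ⟨G, hG1, hG2, hG3⟩ := exists_contraction_of_le hA (le_add_of_nonneg_right hX)
  have hρ1 : ρ.trace.re = 1 := by rw [hρ.2, Complex.one_re]
  -- `1 - Re Tr (G ρ) ≤ Tr B - Re Tr (G B) ≤ Tr B - Tr (lσ) = Tr X ≤ δ`.
  have hf : 1 - δ ≤ (G * ρ).trace.re := by
    have := re_trace_sub_contraction_mul_le hG1 hρB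
    rw [trace_add, Complex.add_re] at this
    linarith
  have hd : 0 < 1 - δ := sub_pos.2 hδ1
  have hle : l ≤ l / (1 - δ) := by
    rw [le_div_iff₀ hd]; nlinarith
  have htr : (G * ρ * Gᴴ).trace.re ≤ 1 := by
    have := re_trace_mul_nonneg (sub_nonneg.2 hG1) hρ.1.nonneg
    rw [Matrix.sub_mul, Matrix.one_mul, trace_sub, Complex.sub_re, hρ1] at this
    rw [trace_mul_comm, ← Matrix.mul_assoc]
    linarith
  -- The factor `1 / (1 - δ)` makes room for a state: `ρ ≤ lσ + X` only forces `l Tr σ ≥ 1 - δ`.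
  have htr2 : 1 ≤ ((l / (1 - δ)) • σ).trace.re := by
    have := re_trace_mono hρB
    rw [trace_add, Complex.add_re, re_trace_smul, hρ1] at this
    rw [re_trace_smul, div_mul_eq_mul_div, le_div_iff₀ hd]
    linarith
  obtain ⟨τ, hτ, hτ1, hτ2⟩ := exists_state_between (conj_nonneg hρ.1.nonneg G)
    (((conj_mono hρB G).trans hG2).trans (real_smul_mono_left hσ hle)) htr htr2
  refine ⟨τ, hτ, hτ2, ?_⟩
  have := re_trace_matPosPart_sub_le hρ hτ hτ1 hd.le hf
  rwa [show 1 - (1 - δ) ^ 2 = δ * (2 - δ) by ring] at this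

end Smoothing

/-! ### Witnesses and the properties of the divergence. -/

section Divergence

open scoped MatrixOrder
open Matrix

variable {n m : Type*}

theorem isHermitian_sub_smul {ρ σ : Matrix n n ℂ} (hρ : ρ.IsHermitian) (hσ : σ.IsHermitian)
    (l : ℝ) : (ρ - l • σ).IsHermitian :=
  hρ.sub (hσ.smul (IsSelfAdjoint.all l))

theorem sub_kronecker (A A' : Matrix n n ℂ) (B : Matrix m m ℂ) :
    (A - A') ⊗ₖ B = A ⊗ₖ B - A' ⊗ₖ B := by
  ext
  simp [sub_mul]

theorem kronecker_sub (A : Matrix n n ℂ) (B B' : Matrix m m ℂ) :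
    A ⊗ₖ (B - B') = A ⊗ₖ B - A ⊗ₖ B' := by
  ext
  simp [mul_sub]

variable [Fintype n] [Fintype m]

theorem kronecker_isHermitian {A : Matrix n n ℂ} {B : Matrix m m ℂ} (hA : A.PosSemidef)
    (hB : B.PosSemidef) : (A ⊗ₖ B).IsHermitian :=
  (hA.kronecker hB).isHermitian

theorem kronecker_mono_left {A A' : Matrix n n ℂ} {B : Matrix m m ℂ} (h : A ≤ A') (hB : 0 ≤ B) :
    A ⊗ₖ B ≤ A' ⊗ₖ B := by
  have := kronecker_nonneg (sub_nonneg.2 h) hB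
  rwa [sub_kronecker, sub_nonneg] at this

theorem kronecker_mono_right {A : Matrix n n ℂ} {B B' : Matrix m m ℂ} (hA : 0 ≤ A) (h : B ≤ B') :
    A ⊗ₖ B ≤ A ⊗ₖ B' := by
  have := kronecker_nonneg hA (sub_nonneg.2 h)
  rwa [kronecker_sub, sub_nonneg] at this

/-- `X` witnesses that `l` is admissible in the infimum defining `dlDiv δ ρ σ`. -/
def IsDLWitness (δ l : ℝ) (ρ σ X : Matrix n n ℂ) : Prop :=
  0 ≤ X ∧ ρ ≤ l • σ + X ∧ X.trace.re ≤ δ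

theorem IsDLWitness.mono {ρ σ X : Matrix n n ℂ} {δ l l' : ℝ} (h : IsDLWitness δ l ρ σ X)
    (hσ : 0 ≤ σ) (hl : l ≤ l') : IsDLWitness δ l' ρ σ X :=
  ⟨h.1, h.2.1.trans (add_le_add_left (real_smul_mono_left hσ hl) X), h.2.2⟩

/-- For `l ≤ 0` one would have `ρ ≤ X`, hence `1 ≤ δ`. This is what excludes the value `-∞`. -/
theorem IsDLWitness.pos {ρ σ X : Matrix n n ℂ} {δ l : ℝ} (h : IsDLWitness δ l ρ σ X)
    (hρ : IsState ρ) (hσ : 0 ≤ σ) (hδ : δ < 1) : 0 < l := by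
  by_contra! hl
  have h1 := re_trace_mono (h.mono hσ hl).2.1
  rw [zero_smul, zero_add, hρ.2, Complex.one_re] at h1
  linarith [h.2.2]

/-- A tensor product of witnesses, expanding the second factor first. -/
theorem IsDLWitness.kronecker {ρ₁ σ₁ X₁ : Matrix n n ℂ} {ρ₂ σ₂ X₂ : Matrix m m ℂ}
    {δ₁ δ₂ l₁ l₂ : ℝ} (h₁ : IsDLWitness δ₁ l₁ ρ₁ σ₁ X₁) (h₂ : IsDLWitness δ₂ l₂ ρ₂ σ₂ X₂)
    (hρ₁ : IsState ρ₁) (hσ₂ : 0 ≤ σ₂) (hl₂ : 0 ≤ l₂) :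
    IsDLWitness (δ₂ + l₂ * (σ₂.trace.re * δ₁)) (l₁ * l₂) (ρ₁ ⊗ₖ ρ₂) (σ₁ ⊗ₖ σ₂)
      (l₂ • (X₁ ⊗ₖ σ₂) + ρ₁ ⊗ₖ X₂) := by
  refine ⟨add_nonneg (real_smul_nonneg (kronecker_nonneg h₁.1 hσ₂) hl₂)
    (kronecker_nonneg hρ₁.1.nonneg h₂.1), ?_, ?_⟩
  · calc ρ₁ ⊗ₖ ρ₂ ≤ ρ₁ ⊗ₖ (l₂ • σ₂ + X₂) := kronecker_mono_right hρ₁.1.nonneg h₂.2.1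
      _ = l₂ • (ρ₁ ⊗ₖ σ₂) + ρ₁ ⊗ₖ X₂ := by rw [kronecker_add, kronecker_smul]
      _ ≤ l₂ • ((l₁ • σ₁ + X₁) ⊗ₖ σ₂) + ρ₁ ⊗ₖ X₂ :=
        add_le_add_left (real_smul_mono (kronecker_mono_left h₁.2.1 hσ₂) hl₂) _
      _ = (l₁ * l₂) • (σ₁ ⊗ₖ σ₂) + (l₂ • (X₁ ⊗ₖ σ₂) + ρ₁ ⊗ₖ X₂) := by
        rw [add_kronecker, smul_kronecker, smul_add, smul_smul, mul_comm l₂ l₁, add_assoc]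
  · rw [trace_add, Complex.add_re, re_trace_smul, re_trace_kronecker h₁.1,
      re_trace_kronecker hρ₁.1.nonneg, hρ₁.2, Complex.one_re, one_mul, add_comm,
      mul_comm X₁.trace.re]
    have := mul_le_mul_of_nonneg_left
      (mul_le_mul_of_nonneg_left h₁.2.2 (re_trace_nonneg hσ₂)) hl₂
    exact add_le_add h₂.2.2 this

/-- A tensor product of witnesses, expanding the first factor first. -/
theorem IsDLWitness.kronecker' {ρ₁ σ₁ X₁ : Matrix n n ℂ} {ρ₂ σ₂ X₂ : Matrix m m ℂ}
    {δ₁ δ₂ l₁ l₂ : ℝ} (h₁ : IsDLWitness δ₁ l₁ ρ₁ σ₁ X₁) (h₂ : IsDLWitness δ₂ l₂ ρ₂ σ₂ X₂)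
    (hρ₂ : IsState ρ₂) (hσ₁ : 0 ≤ σ₁) (hl₁ : 0 ≤ l₁) :
    IsDLWitness (δ₁ + l₁ * (σ₁.trace.re * δ₂)) (l₁ * l₂) (ρ₁ ⊗ₖ ρ₂) (σ₁ ⊗ₖ σ₂)
      (l₁ • (σ₁ ⊗ₖ X₂) + X₁ ⊗ₖ ρ₂) := by
  refine ⟨add_nonneg (real_smul_nonneg (kronecker_nonneg hσ₁ h₂.1) hl₁)
    (kronecker_nonneg h₁.1 hρ₂.1.nonneg), ?_, ?_⟩
  · calc ρ₁ ⊗ₖ ρ₂ ≤ (l₁ • σ₁ + X₁) ⊗ₖ ρ₂ := kronecker_mono_left h₁.2.1 hρ₂.1.nonneg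
      _ = l₁ • (σ₁ ⊗ₖ ρ₂) + X₁ ⊗ₖ ρ₂ := by rw [add_kronecker, smul_kronecker]
      _ ≤ l₁ • (σ₁ ⊗ₖ (l₂ • σ₂ + X₂)) + X₁ ⊗ₖ ρ₂ :=
        add_le_add_left (real_smul_mono (kronecker_mono_right hσ₁ h₂.2.1) hl₁) _
      _ = (l₁ * l₂) • (σ₁ ⊗ₖ σ₂) + (l₁ • (σ₁ ⊗ₖ X₂) + X₁ ⊗ₖ ρ₂) := by
        rw [kronecker_add, kronecker_smul, smul_add, smul_smul, add_assoc]
  · rw [trace_add, Complex.add_re, re_trace_smul, re_trace_kronecker h₁.1,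
      re_trace_kronecker hσ₁, hρ₂.2, Complex.one_re, mul_one, add_comm]
    have := mul_le_mul_of_nonneg_left
      (mul_le_mul_of_nonneg_left h₂.2.2 (re_trace_nonneg hσ₁)) hl₁
    exact add_le_add h₁.2.2 this

variable [DecidableEq n] [DecidableEq m]

theorem re_trace_matPosPart_le_iff_exists_isDLWitness {ρ σ : Matrix n n ℂ} (hρ : ρ.IsHermitian)
    (hσ : σ.IsHermitian) {δ l : ℝ} :
    (matPosPart (ρ - l • σ)).trace.re ≤ δ ↔ ∃ X, IsDLWitness δ l ρ σ X := by
  rw [re_trace_matPosPart_le_iff (isHermitian_sub_smul hρ hσ l)]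
  simp only [IsDLWitness, sub_le_iff_le_add']

theorem IsDLWitness.dlDiv_le {ρ σ X : Matrix n n ℂ} {δ l : ℝ} (h : IsDLWitness δ l ρ σ X)
    (hρ : ρ.IsHermitian) (hσ : σ.IsHermitian) (hl : 0 < l) :
    dlDiv δ ρ σ ≤ (Real.log l : EReal) := by
  rw [← ENNReal.log_ofReal_of_pos hl]
  refine ENNReal.log_monotone (iInf₂_le l.toNNReal ?_)
  rw [Real.coe_toNNReal l hl.le]
  exact (re_trace_matPosPart_le_iff_exists_isDLWitness hρ hσ).2 ⟨X, h⟩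

/-- The infimum defining `dlDiv` is attained when it is finite. -/
theorem dlDiv_eq_top_or_exists_isDLWitness {ρ σ : Matrix n n ℂ} {δ : ℝ} (hρ : IsState ρ)
    (hσ : 0 ≤ σ) (hδ : δ < 1) :
    dlDiv δ ρ σ = ⊤ ∨
      ∃ l : ℝ, 0 < l ∧ dlDiv δ ρ σ = (Real.log l : EReal) ∧ ∃ X, IsDLWitness δ l ρ σ X := by
  refine or_iff_not_imp_left.2 fun htop => ?_
  have hρH := hρ.1.isHermitian
  have hσH := hσ.posSemidef.isHermitian
  have hσ0 := re_trace_nonneg hσ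
  rw [dlDiv, ENNReal.log_eq_top_iff] at htop
  set I : ℝ≥0∞ := ⨅ (l : ℝ≥0) (_ : (matPosPart (ρ - (l : ℝ) • σ)).trace.re ≤ δ), (l : ℝ≥0∞)
    with hI
  -- Closedness at the infimum: for `l` slightly above `I`, the excess `(l - I)σ` is absorbed into
  -- `X` at trace cost at most `ε`. The `+ 1` in the denominator covers `Tr σ = 0`.
  have hw : ∃ X, IsDLWitness δ I.toReal ρ σ X := by
    refine (re_trace_matPosPart_le_iff_exists_isDLWitness hρH hσH).1
      (le_of_forall_pos_le_add fun ε hε => ?_)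
    have hη : 0 < ε / (σ.trace.re + 1) := by positivity
    have hlt : I < I + ENNReal.ofReal (ε / (σ.trace.re + 1)) :=
      ENNReal.lt_add_right htop (by simpa using hη)
    obtain ⟨l, hlδ, hl⟩ : ∃ (l : ℝ≥0) (_ : (matPosPart (ρ - (l : ℝ) • σ)).trace.re ≤ δ),
        (l : ℝ≥0∞) < I + ENNReal.ofReal (ε / (σ.trace.re + 1)) := by
      conv_lhs at hlt => rw [hI]
      simpa only [iInf_lt_iff] using hlt
    have hIl : I.toReal ≤ l := by
      simpa using ENNReal.toReal_mono ENNReal.coe_ne_top (iInf₂_le l hlδ)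
    have hl' : (l : ℝ) ≤ I.toReal + ε / (σ.trace.re + 1) := by
      have := ENNReal.toReal_mono (ENNReal.add_ne_top.2 ⟨htop, ENNReal.ofReal_ne_top⟩) hl.le
      rwa [ENNReal.toReal_add htop ENNReal.ofReal_ne_top, ENNReal.toReal_ofReal hη.le,
        ENNReal.coe_toReal] at this
    obtain ⟨X, hX0, hX, hXδ⟩ :=
      (re_trace_matPosPart_le_iff_exists_isDLWitness hρH hσH).1 hlδ
    refine (re_trace_matPosPart_le_iff_exists_isDLWitness hρH hσH).2
      ⟨(l - I.toReal) • σ + X, add_nonneg (real_smul_nonneg hσ (sub_nonneg.2 hIl)) hX0, ?_, ?_⟩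
    · rwa [← add_assoc, ← add_smul, add_sub_cancel]
    · rw [trace_add, Complex.add_re, re_trace_smul]
      have h1 : (l - I.toReal) * σ.trace.re ≤ ε / (σ.trace.re + 1) * σ.trace.re :=
        mul_le_mul_of_nonneg_right (by linarith) hσ0
      have h2 : ε / (σ.trace.re + 1) * σ.trace.re ≤ ε := by
        rw [div_mul_eq_mul_div, div_le_iff₀ (by positivity)]
        nlinarith
      linarith
  obtain ⟨X, hX⟩ := hw
  have hpos := hX.pos hρ hσ hδ
  refine ⟨I.toReal, hpos, ?_, X, hX⟩
  rw [dlDiv, ← hI, ← ENNReal.log_ofReal_of_pos hpos, ENNReal.ofReal_toReal htop]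

theorem dlDiv_map_le {δ : ℝ} (hδ : δ < 1) {ρ σ : Matrix n n ℂ} (hρ : IsState ρ)
    (hσ : σ.PosSemidef) {N : Matrix n n ℂ →ₗ[ℂ] Matrix m m ℂ} (hN : IsPositiveMap N)
    (hN' : IsTraceNonincreasing N) : dlDiv δ (N ρ) (N σ) ≤ dlDiv δ ρ σ := by
  rcases dlDiv_eq_top_or_exists_isDLWitness hρ hσ.nonneg hδ with h | ⟨l, hl, h, X, hX0, hX, hXδ⟩
  · rw [h]; exact le_top
  rw [h]
  have hw : IsDLWitness δ l (N ρ) (N σ) (N X) := by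
    refine ⟨(hN X hX0.posSemidef).nonneg, ?_, (hN' X hX0.posSemidef).trans hXδ⟩
    have := hN _ (Matrix.le_iff.1 hX)
    rwa [map_sub, map_add, LinearMap.map_smul_of_tower] at this
  exact hw.dlDiv_le (hN ρ hρ.1).isHermitian (hN σ hσ).isHermitian hl

theorem dlDiv_sum_le {k : ℕ} {ρ σ : Fin k → Matrix n n ℂ} {p δ : Fin k → ℝ}
    (hρ : ∀ i, IsState (ρ i)) (hσ : ∀ i, (σ i).PosSemidef) (hp : ∀ i, 0 ≤ p i)
    (hp1 : ∑ i, p i = 1) (hδ : ∀ i, δ i < 1) :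
    dlDiv (∑ i, p i * δ i) (∑ i, p i • ρ i) (∑ i, p i • σ i) ≤
      ⨆ i, dlDiv (δ i) (ρ i) (σ i) := by
  by_cases htop : ∃ i, dlDiv (δ i) (ρ i) (σ i) = ⊤
  · obtain ⟨i, hi⟩ := htop
    exact le_top.trans (hi ▸ le_iSup (fun i => dlDiv (δ i) (ρ i) (σ i)) i)
  have hex := fun i => (dlDiv_eq_top_or_exists_isDLWitness (hρ i) (hσ i).nonneg
    (hδ i)).resolve_left fun h => htop ⟨i, h⟩
  choose l hl hD X hX using hex
  have hne : Nonempty (Fin k) := by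
    by_contra hempty
    rw [not_nonempty_iff] at hempty
    simp at hp1
  obtain ⟨j, hj⟩ := Finite.exists_max l
  -- The averaged witnesses need a common `l`; the largest one, `l j`, is admissible for every
  -- index.
  have hsum : ∀ A : Fin k → Matrix n n ℂ, (∀ i, 0 ≤ A i) → 0 ≤ ∑ i, p i • A i := fun A hA =>
    Finset.sum_nonneg fun i _ => real_smul_nonneg (hA i) (hp i)
  have hw : IsDLWitness (∑ i, p i * δ i) (l j) (∑ i, p i • ρ i) (∑ i, p i • σ i)
      (∑ i, p i • X i) := by
    refine ⟨hsum X fun i => (hX i).1, ?_, ?_⟩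
    · rw [Finset.smul_sum, ← Finset.sum_add_distrib]
      refine Finset.sum_le_sum fun i _ => ?_
      have := real_smul_mono ((hX i).mono (hσ i).nonneg (hj i)).2.1 (hp i)
      rwa [smul_add, smul_comm (p i) (l j)] at this
    · rw [trace_sum, Complex.re_sum]
      refine Finset.sum_le_sum fun i _ => ?_
      rw [re_trace_smul]
      exact mul_le_mul_of_nonneg_left (hX i).2.2 (hp i)
  refine (hw.dlDiv_le (hsum ρ fun i => (hρ i).1.nonneg).posSemidef.isHermitian
    (hsum σ fun i => (hσ i).nonneg).posSemidef.isHermitian (hl j)).trans ?_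
  rw [← hD j]
  exact le_iSup (fun i => dlDiv (δ i) (ρ i) (σ i)) j

/-- If `τ ≤ lσ` is within distance `δ` of `ρ`, then `ρ = τ + (ρ - τ) ≤ lσ + (ρ - τ)₊`, and the trace
of the last term is the distance. -/
theorem dlDiv_le_smoothDMax {ρ σ : Matrix n n ℂ} (δ : ℝ) (hρ : IsState ρ)
    (hσ : σ.PosSemidef) : dlDiv δ ρ σ ≤ smoothDMax δ ρ σ := by
  refine le_iInf fun τ => le_iInf fun hτ => le_iInf fun hd => ?_
  rw [traceDist_eq hρ hτ] at hd
  refine ENNReal.log_monotone (le_iInf₂ fun l hl => iInf₂_le l ?_)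
  refine (re_trace_matPosPart_le_iff_exists_isDLWitness hρ.1.isHermitian hσ.isHermitian).2
    ⟨matPosPart (ρ - τ), matPosPart_nonneg _, ?_, hd⟩
  have h1 : τ ≤ (l : ℝ) • σ := Matrix.le_iff.2 hl
  have h2 := le_matPosPart (hρ.1.isHermitian.sub hτ.1.isHermitian)
  calc ρ = τ + (ρ - τ) := by abel
    _ ≤ _ := add_le_add h1 h2

theorem smoothDMax_le {δ : ℝ} (hδ0 : 0 ≤ δ) (hδ1 : δ < 1) {ρ σ : Matrix n n ℂ}
    (hρ : IsState ρ) (hσ : σ.PosSemidef) :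
    smoothDMax (√(δ * (2 - δ))) ρ σ ≤ dlDiv δ ρ σ - (Real.log (1 - δ) : EReal) := by
  rcases dlDiv_eq_top_or_exists_isDLWitness hρ hσ.nonneg hδ1 with
    h | ⟨l, hl, h, X, hX0, hX, hXδ⟩
  · rw [h, EReal.top_sub_coe]; exact le_top
  have hd : 0 < 1 - δ := sub_pos.2 hδ1
  obtain ⟨τ, hτ, hτσ, hd'⟩ := exists_state_le_smul hρ hσ.nonneg hl.le hδ0 hδ1 hX0
    (sub_le_iff_le_add'.2 hX) hXδ
  rw [← traceDist_eq hρ hτ] at hd'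
  refine (iInf_le_of_le τ (iInf₂_le hτ hd')).trans ?_
  rw [h, ← EReal.coe_sub, ← Real.log_div hl.ne' hd.ne',
    ← ENNReal.log_ofReal_of_pos (div_pos hl hd)]
  refine ENNReal.log_monotone (iInf₂_le (l / (1 - δ)).toNNReal ?_)
  rw [Real.coe_toNNReal _ (div_pos hl hd).le]
  exact Matrix.le_iff.1 hτσ

theorem sqrt_mul_two_sub_mem_Ioo {δ : ℝ} (hδ : δ ∈ Set.Ioo (0 : ℝ) 1) :
    √(δ * (2 - δ)) ∈ Set.Ioo (0 : ℝ) 1 := by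
  obtain ⟨h0, h1⟩ := hδ
  refine ⟨Real.sqrt_pos.2 (mul_pos h0 (by linarith)), ?_⟩
  rw [Real.sqrt_lt' one_pos]
  nlinarith

theorem one_sub_sqrt_mem_Ioo {δ : ℝ} (hδ : δ ∈ Set.Ioo (0 : ℝ) 1) :
    1 - √(1 - δ ^ 2) ∈ Set.Ioo (0 : ℝ) 1 := by
  obtain ⟨h0, h1⟩ := hδ
  have h2 : 0 < √(1 - δ ^ 2) := Real.sqrt_pos.2 (by nlinarith)
  have h3 : √(1 - δ ^ 2) < 1 := by
    rw [Real.sqrt_lt' one_pos]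
    nlinarith
  constructor <;> linarith

theorem sqrt_one_sub_sqrt {δ : ℝ} (hδ : δ ∈ Set.Ioo (0 : ℝ) 1) :
    √((1 - √(1 - δ ^ 2)) * (2 - (1 - √(1 - δ ^ 2)))) = δ := by
  obtain ⟨h0, h1⟩ := hδ
  have h2 : √(1 - δ ^ 2) ^ 2 = 1 - δ ^ 2 := Real.sq_sqrt (by nlinarith)
  rw [show (1 - √(1 - δ ^ 2)) * (2 - (1 - √(1 - δ ^ 2))) = δ ^ 2 by linear_combination -h2,
    Real.sqrt_sq h0.le]

theorem dlDiv_zero_kronecker_le {ρ₁ σ₁ : Matrix n n ℂ} {ρ₂ σ₂ : Matrix m m ℂ}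
    (hρ₁ : IsState ρ₁) (hρ₂ : IsState ρ₂) (hσ₁ : σ₁.PosSemidef) (hσ₂ : σ₂.PosSemidef) :
    dlDiv 0 (ρ₁ ⊗ₖ ρ₂) (σ₁ ⊗ₖ σ₂) ≤ dlDiv 0 ρ₁ σ₁ + dlDiv 0 ρ₂ σ₂ := by
  rcases dlDiv_eq_top_or_exists_isDLWitness hρ₁ hσ₁.nonneg one_pos with
    h₁ | ⟨l₁, hl₁, h₁, X₁, hX₁⟩ <;>
  rcases dlDiv_eq_top_or_exists_isDLWitness hρ₂ hσ₂.nonneg one_pos with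
    h₂ | ⟨l₂, hl₂, h₂, X₂, hX₂⟩
  -- If one divergence is `+∞`, the other is either `+∞` or a real logarithm, never `-∞`, so the sum
  -- is `+∞`.
  any_goals rw [h₁, h₂]; simp
  rw [h₁, h₂, ← EReal.coe_add, ← Real.log_mul hl₁.ne' hl₂.ne']
  have := hX₁.kronecker hX₂ hρ₁ hσ₂.nonneg hl₂.le
  rw [mul_zero, mul_zero, add_zero] at this
  exact this.dlDiv_le (kronecker_isHermitian hρ₁.1 hρ₂.1) (kronecker_isHermitian hσ₁ hσ₂)
    (mul_pos hl₁ hl₂)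

theorem dlDiv_kronecker_le_of_isState {ρ₁ σ₁ : Matrix n n ℂ} {ρ₂ σ₂ : Matrix m m ℂ}
    (hρ₁ : IsState ρ₁) (hρ₂ : IsState ρ₂) (hσ₁ : IsState σ₁) (hσ₂ : IsState σ₂)
    {δ₁ δ₂ δ : ℝ} (hδ₁ : δ₁ < 1) (hδ₂ : δ₂ < 1)
    (hδ : (δ : EReal) =
      min ((δ₁ : EReal) + (EReal.exp (dlDiv δ₁ ρ₁ σ₁) : EReal) * (δ₂ : EReal))
        ((δ₂ : EReal) + (EReal.exp (dlDiv δ₂ ρ₂ σ₂) : EReal) * (δ₁ : EReal))) :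
    dlDiv δ (ρ₁ ⊗ₖ ρ₂) (σ₁ ⊗ₖ σ₂) ≤ dlDiv δ₁ ρ₁ σ₁ + dlDiv δ₂ ρ₂ σ₂ := by
  rcases dlDiv_eq_top_or_exists_isDLWitness hρ₁ hσ₁.1.nonneg hδ₁ with
    h₁ | ⟨l₁, hl₁, h₁, X₁, hX₁⟩ <;>
  rcases dlDiv_eq_top_or_exists_isDLWitness hρ₂ hσ₂.1.nonneg hδ₂ with
    h₂ | ⟨l₂, hl₂, h₂, X₂, hX₂⟩
  any_goals rw [h₁, h₂]; simp
  have hexp : ∀ l : ℝ, 0 < l → (EReal.exp (Real.log l : EReal) : EReal) = (l : EReal) :=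
    fun l hl => by
      rw [EReal.exp_coe, Real.exp_log hl, EReal.coe_ennreal_ofReal, max_eq_left hl.le]
  rw [h₁, h₂, hexp l₁ hl₁, hexp l₂ hl₂] at hδ
  rw [h₁, h₂, ← EReal.coe_add, ← Real.log_mul hl₁.ne' hl₂.ne']
  have hw : ∃ X, IsDLWitness δ (l₁ * l₂) (ρ₁ ⊗ₖ ρ₂) (σ₁ ⊗ₖ σ₂) X := by
    -- Each argument of the minimum is the error from expanding one of the two factors first; `Tr σᵢ
    -- = 1` removes the trace factor.
    rcases min_choice ((δ₁ : EReal) + (l₁ : EReal) * (δ₂ : EReal))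
      ((δ₂ : EReal) + (l₂ : EReal) * (δ₁ : EReal)) with h | h
    · rw [h] at hδ
      have hδ' : δ = δ₁ + l₁ * δ₂ := by exact_mod_cast hδ
      have := hX₁.kronecker' hX₂ hρ₂ hσ₁.1.nonneg hl₁.le
      rw [hσ₁.2, Complex.one_re, one_mul, ← hδ'] at this
      exact ⟨_, this⟩
    · rw [h] at hδ
      have hδ' : δ = δ₂ + l₂ * δ₁ := by exact_mod_cast hδ
      have := hX₁.kronecker hX₂ hρ₁ hσ₂.1.nonneg hl₂.le
      rw [hσ₂.2, Complex.one_re, one_mul, ← hδ'] at this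
      exact ⟨_, this⟩
  obtain ⟨X, hX⟩ := hw
  exact hX.dlDiv_le (kronecker_isHermitian hρ₁.1 hρ₂.1) (kronecker_isHermitian hσ₁.1 hσ₂.1)
    (mul_pos hl₁ hl₂)

theorem dlDiv_kronecker_le {ρ₁ σ₁ : Matrix n n ℂ} {ρ₂ σ₂ : Matrix m m ℂ}
    (hρ₁ : IsState ρ₁) (hρ₂ : IsState ρ₂) (hσ₁ : σ₁.PosSemidef) (hσ₂ : σ₂.PosSemidef)
    {δ₁ δ₂ : ℝ} (hδ₁ : δ₁ ∈ Set.Ioo (0 : ℝ) 1) (hδ₂ : δ₂ ∈ Set.Ioo (0 : ℝ) 1) :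
    dlDiv (√(δ₁ * (2 - δ₁)) + √(δ₂ * (2 - δ₂))) (ρ₁ ⊗ₖ ρ₂) (σ₁ ⊗ₖ σ₂) ≤
      dlDiv δ₁ ρ₁ σ₁ + dlDiv δ₂ ρ₂ σ₂ - (Real.log ((1 - δ₁) * (1 - δ₂)) : EReal) := by
  rcases dlDiv_eq_top_or_exists_isDLWitness hρ₁ hσ₁.nonneg hδ₁.2 with
    h₁ | ⟨l₁, hl₁, h₁, X₁, hX₁⟩ <;>
  rcases dlDiv_eq_top_or_exists_isDLWitness hρ₂ hσ₂.nonneg hδ₂.2 with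
    h₂ | ⟨l₂, hl₂, h₂, X₂, hX₂⟩
  any_goals rw [h₁, h₂]; simp
  have hd₁ := sub_pos.2 hδ₁.2
  have hd₂ := sub_pos.2 hδ₂.2
  have hm₁ := div_pos hl₁ hd₁
  have hm₂ := div_pos hl₂ hd₂
  obtain ⟨τ₁, hτ₁, hτσ₁, ht₁⟩ := exists_state_le_smul hρ₁ hσ₁.nonneg hl₁.le hδ₁.1.le hδ₁.2
    hX₁.1 (sub_le_iff_le_add'.2 hX₁.2.1) hX₁.2.2
  obtain ⟨τ₂, hτ₂, hτσ₂, ht₂⟩ := exists_state_le_smul hρ₂ hσ₂.nonneg hl₂.le hδ₂.1.le hδ₂.2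
    hX₂.1 (sub_le_iff_le_add'.2 hX₂.2.1) hX₂.2.2
  have hY₁ := le_matPosPart (hρ₁.1.isHermitian.sub hτ₁.1.isHermitian)
  have hY₂ := le_matPosPart (hρ₂.1.isHermitian.sub hτ₂.1.isHermitian)
  set Y₁ := matPosPart (ρ₁ - τ₁)
  set Y₂ := matPosPart (ρ₂ - τ₂)
  have hY₁0 : 0 ≤ Y₁ := matPosPart_nonneg _
  have hY₂0 : 0 ≤ Y₂ := matPosPart_nonneg _
  -- Telescoping: `ρ₁ ⊗ ρ₂ - τ₁ ⊗ τ₂ = (ρ₁ - τ₁) ⊗ ρ₂ + τ₁ ⊗ (ρ₂ - τ₂)`. All of `ρ₂`, `τ₁` have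
  -- trace one, so the two distances simply add.
  have hw : IsDLWitness (√(δ₁ * (2 - δ₁)) + √(δ₂ * (2 - δ₂)))
      (l₁ / (1 - δ₁) * (l₂ / (1 - δ₂))) (ρ₁ ⊗ₖ ρ₂) (σ₁ ⊗ₖ σ₂) (Y₁ ⊗ₖ ρ₂ + τ₁ ⊗ₖ Y₂) := by
    refine ⟨add_nonneg (kronecker_nonneg hY₁0 hρ₂.1.nonneg)
      (kronecker_nonneg hτ₁.1.nonneg hY₂0), ?_, ?_⟩
    · calc ρ₁ ⊗ₖ ρ₂ = τ₁ ⊗ₖ τ₂ + ((ρ₁ - τ₁) ⊗ₖ ρ₂ + τ₁ ⊗ₖ (ρ₂ - τ₂)) := by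
            rw [sub_kronecker, kronecker_sub]; abel
        _ ≤ _ := by
          refine add_le_add ?_ (add_le_add (kronecker_mono_left hY₁ hρ₂.1.nonneg)
            (kronecker_mono_right hτ₁.1.nonneg hY₂))
          refine (kronecker_mono_left hτσ₁ hτ₂.1.nonneg).trans ?_
          refine (kronecker_mono_right (real_smul_nonneg hσ₁.nonneg hm₁.le) hτσ₂).trans ?_
          rw [smul_kronecker, kronecker_smul, smul_smul]
    · rw [trace_add, Complex.add_re, re_trace_kronecker hY₁0, re_trace_kronecker hτ₁.1.nonneg,
        hρ₂.2, hτ₁.2, Complex.one_re, mul_one, one_mul]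
      exact add_le_add ht₁ ht₂
  rw [h₁, h₂, ← EReal.coe_add, ← EReal.coe_sub, ← Real.log_mul hl₁.ne' hl₂.ne',
    ← Real.log_div (mul_pos hl₁ hl₂).ne' (mul_pos hd₁ hd₂).ne', ← div_mul_div_comm]
  exact hw.dlDiv_le (kronecker_isHermitian hρ₁.1 hρ₂.1) (kronecker_isHermitian hσ₁ hσ₂)
    (mul_pos hm₁ hm₂)

end Divergence

theorem mainTheorem3 {n m : Type*} [Fintype n] [DecidableEq n] [Fintype m] [DecidableEq m] :
    -- (1) data processing under positive, trace non-increasing maps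
    (∀ δ ∈ Set.Ioo (0 : ℝ) 1, ∀ ρ σ : Matrix n n ℂ, IsState ρ → σ.PosSemidef →
      ∀ N : Matrix n n ℂ →ₗ[ℂ] Matrix m m ℂ, IsPositiveMap N → IsTraceNonincreasing N →
        dlDiv δ (N ρ) (N σ) ≤ dlDiv δ ρ σ) ∧
    -- (2) joint quasi-convexity, with a common and with a mixed smoothing parameter
    (∀ (k : ℕ) (ρ σ : Fin k → Matrix n n ℂ) (p : Fin k → ℝ),
      (∀ i, IsState (ρ i)) → (∀ i, (σ i).PosSemidef) →
      (∀ i, p i ∈ Set.Icc (0 : ℝ) 1) → ∑ i, p i = 1 →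
        (∀ δ ∈ Set.Ioo (0 : ℝ) 1,
          dlDiv δ (∑ i, p i • ρ i) (∑ i, p i • σ i) ≤ ⨆ i, dlDiv δ (ρ i) (σ i)) ∧
        (∀ δ : Fin k → ℝ, (∀ i, δ i ∈ Set.Ioo (0 : ℝ) 1) →
          dlDiv (∑ i, p i * δ i) (∑ i, p i • ρ i) (∑ i, p i • σ i) ≤
            ⨆ i, dlDiv (δ i) (ρ i) (σ i))) ∧
    -- (3) relation to the smooth max-relative entropy
    (∀ δ ∈ Set.Ioo (0 : ℝ) 1, ∀ ρ σ : Matrix n n ℂ, IsState ρ → σ.PosSemidef →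
      dlDiv δ ρ σ ≤ smoothDMax δ ρ σ ∧
      1 - √(1 - δ ^ 2) ∈ Set.Ioo (0 : ℝ) 1 ∧
      smoothDMax δ ρ σ ≤
        dlDiv (1 - √(1 - δ ^ 2)) ρ σ - (Real.log (1 - (1 - √(1 - δ ^ 2))) : EReal) ∧
      smoothDMax (√(δ * (2 - δ))) ρ σ ≤ dlDiv δ ρ σ - (Real.log (1 - δ) : EReal)) ∧
    -- (4) quasi subadditivity, and its two special cases
    (∀ (ρ₁ σ₁ : Matrix n n ℂ) (ρ₂ σ₂ : Matrix m m ℂ),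
      IsState ρ₁ → IsState ρ₂ → σ₁.PosSemidef → σ₂.PosSemidef →
        (∀ δ₁ ∈ Set.Ioo (0 : ℝ) 1, ∀ δ₂ ∈ Set.Ioo (0 : ℝ) 1,
          √(δ₁ * (2 - δ₁)) ∈ Set.Ioo (0 : ℝ) 1 ∧ √(δ₂ * (2 - δ₂)) ∈ Set.Ioo (0 : ℝ) 1 ∧
          (√(δ₁ * (2 - δ₁)) + √(δ₂ * (2 - δ₂)) < 1 →
            dlDiv (√(δ₁ * (2 - δ₁)) + √(δ₂ * (2 - δ₂))) (ρ₁ ⊗ₖ ρ₂) (σ₁ ⊗ₖ σ₂) ≤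
              dlDiv δ₁ ρ₁ σ₁ + dlDiv δ₂ ρ₂ σ₂ -
                (Real.log ((1 - δ₁) * (1 - δ₂)) : EReal))) ∧
        dlDiv 0 (ρ₁ ⊗ₖ ρ₂) (σ₁ ⊗ₖ σ₂) ≤ dlDiv 0 ρ₁ σ₁ + dlDiv 0 ρ₂ σ₂ ∧
        (IsState σ₁ → IsState σ₂ →
          ∀ δ₁ ∈ Set.Ioo (0 : ℝ) 1, ∀ δ₂ ∈ Set.Ioo (0 : ℝ) 1, ∀ δ : ℝ,
            (δ : EReal) =
              min ((δ₁ : EReal) + (EReal.exp (dlDiv δ₁ ρ₁ σ₁) : EReal) * (δ₂ : EReal))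
                ((δ₂ : EReal) + (EReal.exp (dlDiv δ₂ ρ₂ σ₂) : EReal) * (δ₁ : EReal)) →
            dlDiv δ (ρ₁ ⊗ₖ ρ₂) (σ₁ ⊗ₖ σ₂) ≤ dlDiv δ₁ ρ₁ σ₁ + dlDiv δ₂ ρ₂ σ₂)) := by
  refine ⟨fun δ hδ ρ σ hρ hσ N hN hN' => dlDiv_map_le hδ.2 hρ hσ hN hN',
    fun k ρ σ p hρ hσ hp hp1 => ⟨fun δ hδ => ?_, fun δ hδ =>
      dlDiv_sum_le hρ hσ (fun i => (hp i).1) hp1 fun i => (hδ i).2⟩,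
    fun δ hδ ρ σ hρ hσ => ⟨dlDiv_le_smoothDMax δ hρ hσ, one_sub_sqrt_mem_Ioo hδ, ?_,
      smoothDMax_le hδ.1.le hδ.2 hρ hσ⟩,
    fun ρ₁ σ₁ ρ₂ σ₂ hρ₁ hρ₂ hσ₁ hσ₂ => ⟨fun δ₁ hδ₁ δ₂ hδ₂ =>
      ⟨sqrt_mul_two_sub_mem_Ioo hδ₁, sqrt_mul_two_sub_mem_Ioo hδ₂,
        fun _ => dlDiv_kronecker_le hρ₁ hρ₂ hσ₁ hσ₂ hδ₁ hδ₂⟩,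
      dlDiv_zero_kronecker_le hρ₁ hρ₂ hσ₁ hσ₂,
      fun hσ₁' hσ₂' δ₁ hδ₁ δ₂ hδ₂ δ hδ =>
        dlDiv_kronecker_le_of_isState hρ₁ hρ₂ hσ₁' hσ₂' hδ₁.2 hδ₂.2 hδ⟩⟩
  · have := dlDiv_sum_le (δ := fun _ => δ) hρ hσ (fun i => (hp i).1) hp1 fun _ => hδ.2
    rwa [← Finset.sum_mul, hp1, one_mul] at this
  -- The map `δ ↦ √(δ (2 - δ))` sends `1 - √(1 - δ²)` back to `δ`, so this is the reparametrized
  -- bound.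
  · have hδ' := one_sub_sqrt_mem_Ioo hδ
    have := smoothDMax_le hδ'.1.le hδ'.2 hρ hσ
    rwa [sqrt_one_sub_sqrt hδ] at this
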